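/- Consider $K\ge 1$ users and slots $n=1,2,\dots$. In slot $n$ user $k$ has rate $R_k(n)=r_kX_k(n)$, where $r_k>0$ and the $X_k(n)$ are i.i.d. (over $k$ and $n$), non-negative, of mean one, with known law. Probing the rate of one user costs a fraction $\beta\in(0,1)$ of the slot. The JPS-PF algorithm (joint probing and scheduling for proportional fairness) starts from $T_k(0)=1$. In slot $n$, with $t=T(n-1)$, it orders the users $k_1,\dots,k_K$ by descending $r_k/t_k$, ties being broken uniformly at random, independently of everything else. It probes them in this order, at least one user; after $j$ probes, with $w_j=\max_{i\le j}R_{k_i}(n)/t_{k_i}$, it probes $k_{j+1}$ if and only if $j<K$ and $$(1-j\beta)\,w_j<(1-(j+1)\beta)\,\mathbb E\Big[w\vee \frac{R_{k_{j+1}}}{t_{k_{j+1}}}\Big]_{w=w_j},$$ and otherwise it stops. (Quotients lie in $[0,\infty]$, with $a/0=\infty$ for $a>0$ and $0/0=0$; a continuation factor $1-(j+1)\beta\le 0$ means stopping.) If it stops after $J$ probes, the destination is the probed user with the largest $R_k(n)/t_k$ (the first such user in the probing order). With $B_k(n)=(1-J\beta)R_k(n)$ for the destination $k$ and $B_k(n)=0$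 for all other users, $T_k(n)=\frac{n-1}{n}T_k(n-1)+\frac1nB_k(n)$. For a throughput vector $t\in[0,\infty)^K$ let $p_k(t)$ be the probability that user $k$ is the destination in a slot before which the throughput vector is $t$, and $b_k(t)$ the mean of $B_k$ in such a slot. A steady state is a vector $t\in(0,\infty)^K$ with $b_k(t)=t_k$ for all $k$, i.e. a positive rest point of $\dot T=\mathbb E[B\mid T]-T$. Then: (i) for all $n\ge 1$ and all $k$, $p_k(T(n-1))$ is a version of the conditional probability, given $T(n-1)$, that user $k$ is the destination in slot $n$; (ii) there is exactly one steady state $T^*$; (iii) in the steady state each user is the destination with the same probability: $p_k(T^*)=1/K$ for $k=1,\dots,K$; the same holds at every deterministic vector $t$ to which $T(n)$ converges almost surely. -/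

import Mathlib

open scoped NNReal ENNReal
open MeasureTheory ProbabilityTheory Filter Topology

noncomputable section

namespace JPS

instance permMeasurableSpace (K : ℕ) : MeasurableSpace (Equiv.Perm (Fin K)) := ⊤

/-- The parameters of the network: `K` users; user `k` has mean rate `r k`, and its achievable
rate in a slot is `r k * X`, where the normalized rate `X ≥ 0` has law `law` (the same for all
users) of mean one; probing one user costs the fraction `β` of the slot. -/
structure Network (K : ℕ) where
  law : Measure ℝ≥0
  isProb : IsProbabilityMeasure law
  mean_one : ∫⁻ x, (x : ℝ≥0∞) ∂law = 1
  r : Fin K → ℝ≥0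
  r_pos : ∀ k, 0 < r k
  β : ℝ
  β_pos : 0 < β
  β_lt_one : β < 1

namespace Network

variable {K : ℕ} (N : Network K)

/-! ### One slot

Below `t k` is the throughput of user `k` before the slot, `x k` its normalized rate in the slot
and `ρ` a shuffle of the users.  Throughput-normalized rates are extended nonnegative reals: a
positive rate divided by a zero throughput is `∞` (and `0 / 0 = 0`). -/

/-- Throughput-normalized mean rate `r k / t k`. -/
def meanRatio (t : Fin K → ℝ≥0) (k : Fin K) : ℝ≥0∞ := (N.r k : ℝ≥0∞) / t k

/-- Throughput-normalized rate `R k / t k` with `R k = r k * x k`. -/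
def ratio (t x : Fin K → ℝ≥0) (k : Fin K) : ℝ≥0∞ := ((N.r k * x k : ℝ≥0) : ℝ≥0∞) / t k

/-- The probing order: `order t ρ i` is the `(i+1)`-st user in the list of all users sorted by
descending throughput-normalized mean rate.  Users are first shuffled by `ρ`, then sorted by a
stable sort; so a uniformly distributed `ρ` breaks ties uniformly at random. -/
def order (t : Fin K → ℝ≥0) (ρ : Equiv.Perm (Fin K)) : Equiv.Perm (Fin K) :=
  (Tuple.sort fun i => OrderDual.toDual (N.meanRatio t (ρ i))).trans ρ

/-- `w` after `j` probes: the largest throughput-normalized rate among the first `j` users in the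
probing order `σ` (and `0` for `j = 0`). -/
def best (t x : Fin K → ℝ≥0) (σ : Equiv.Perm (Fin K)) (j : ℕ) : ℝ≥0∞ :=
  ⨆ i : Fin K, ⨆ _ : (i : ℕ) < j, N.ratio t x (σ i)

/-- The fraction of the slot which is left for transmission after `j` probes. -/
def remaining (j : ℕ) : ℝ≥0 := Real.toNNReal (1 - j * N.β)

/-- `𝔼[w ∨ R k / t k]`. -/
def lookAhead (t : Fin K → ℝ≥0) (w : ℝ≥0∞) (k : Fin K) : ℝ≥0∞ :=
  ∫⁻ y, max w (((N.r k * y : ℝ≥0) : ℝ≥0∞) / t k) ∂N.law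

/-- After `j` probes another user is probed: there is a next user, and stopping now is worth less
than probing exactly one more user. -/
def Continues (t x : Fin K → ℝ≥0) (σ : Equiv.Perm (Fin K)) (j : ℕ) : Prop :=
  ∃ h : j < K, (N.remaining j : ℝ≥0∞) * N.best t x σ j <
    N.remaining (j + 1) * N.lookAhead t (N.best t x σ j) (σ ⟨j, h⟩)

/-- The number `J` of probed users (at least one user is probed). -/
def numProbes (t x : Fin K → ℝ≥0) (σ : Equiv.Perm (Fin K)) : ℕ :=
  sInf {j | 1 ≤ j ∧ ¬ N.Continues t x σ j}

/-- User `k` is the destination: it has been probed and has the largest throughput-normalized rate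
among the probed users (the first one in the probing order, if there are several). -/
def IsDest (t x : Fin K → ℝ≥0) (σ : Equiv.Perm (Fin K)) (k : Fin K) : Prop :=
  ∃ i : Fin K, σ i = k ∧ (i : ℕ) < N.numProbes t x σ ∧
    (∀ l : Fin K, (l : ℕ) < N.numProbes t x σ → N.ratio t x (σ l) ≤ N.ratio t x k) ∧
    (∀ l : Fin K, l < i → N.ratio t x (σ l) < N.ratio t x k)

open Classical in
/-- The service `B k = (1 - J β) R k I k` of user `k` in the slot. -/
def service (t x : Fin K → ℝ≥0) (σ : Equiv.Perm (Fin K)) (k : Fin K) : ℝ≥0 :=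
  if N.IsDest t x σ k then N.remaining (N.numProbes t x σ) * (N.r k * x k) else 0

/-- The law of the randomness of one slot: i.i.d. normalized rates of the `K` users, and
independently a uniformly distributed shuffle. -/
def slotLaw : Measure ((Fin K → ℝ≥0) × Equiv.Perm (Fin K)) :=
  (Measure.pi fun _ => N.law).prod (PMF.uniformOfFintype (Equiv.Perm (Fin K))).toMeasure

/-- The probability that user `k` is the destination in a slot before which the throughput vector
is `t`. -/
def destProb (t : Fin K → ℝ≥0) (k : Fin K) : ℝ≥0∞ :=
  N.slotLaw {z | N.IsDest t z.1 (N.order t z.2) k}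

/-- The mean service of user `k` in a slot before which the throughput vector is `t`, that is
`𝔼[B k (n) | T (n-1) = t]`. -/
def meanService (t : Fin K → ℝ≥0) (k : Fin K) : ℝ≥0∞ :=
  ∫⁻ z, (N.service t z.1 (N.order t z.2) k : ℝ≥0∞) ∂N.slotLaw

/-- Steady state: a positive rest point of the mean dynamics `T' = 𝔼[B | T] - T`. -/
def IsSteadyState (t : Fin K → ℝ≥0) : Prop :=
  (∀ k, 0 < t k) ∧ ∀ k, N.meanService t k = t k

/-! ### The algorithm over all slots -/

/-- `X n k` is the normalized rate of user `k` in slot `n + 1`, and `ρ n` the shuffle used in that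
slot: all these are independent, the rates have law `N.law`, the shuffles are uniform. -/
structure IsInput {Ω : Type*} [MeasurableSpace Ω] (μ : Measure Ω)
    (X : ℕ → Fin K → Ω → ℝ≥0) (ρ : ℕ → Ω → Equiv.Perm (Fin K)) : Prop where
  measurable_rate : ∀ n k, Measurable (X n k)
  measurable_shuffle : ∀ n, Measurable (ρ n)
  law_slot : ∀ n, μ.map (fun ω => ((fun k => X n k ω), ρ n ω)) = N.slotLaw
  indep : iIndepFun (fun n ω => ((fun k => X n k ω), ρ n ω)) μ

/-- The throughput vector `T(n)` after `n` slots of the algorithm: `T_k(0) = 1` and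
`T_k(n+1) = n/(n+1) * T_k(n) + 1/(n+1) * B_k(n+1)`. -/
def throughput {Ω : Type*} (X : ℕ → Fin K → Ω → ℝ≥0) (ρ : ℕ → Ω → Equiv.Perm (Fin K)) :
    ℕ → Ω → Fin K → ℝ≥0
  | 0, _ => fun _ => 1
  | n + 1, ω => fun k =>
      let t := throughput X ρ n ω
      (n : ℝ≥0) / (n + 1) * t k +
        1 / ((n : ℝ≥0) + 1) * N.service t (fun l => X n l ω) (N.order t (ρ n ω)) k

/-- The event that user `k` is the destination in slot `n + 1`. -/
def destEvent {Ω : Type*} (X : ℕ → Fin K → Ω → ℝ≥0) (ρ : ℕ → Ω → Equiv.Perm (Fin K))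
    (n : ℕ) (k : Fin K) : Set Ω :=
  {ω | N.IsDest (N.throughput X ρ n ω) (fun l => X n l ω)
    (N.order (N.throughput X ρ n ω) (ρ n ω)) k}

end Network

end JPS

end

/-!
Write `u_k = r_k / t_k` for the normalized mean rates. The whole argument rests on one comparison:
if `u_j < u_i`, then `b_j(t) / r_j ≤ b_i(t) / r_i` (`meanService_mul_le`). It is proved by exchanging
the rates of `i` and `j`, which preserves the law of a slot. User `i` is probed before user `j`, so
if `j` is the destination, then after the exchange `i` has an even larger normalized rate. Up to the
probe of `i` nothing changes, and the stopping rule has a threshold form (`continue_of_le`), so a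
larger best rate can only stop the probing earlier: `i` is the destination, and no more users are
probed (`isDest_swap`).

At a steady state the comparison reads `t_j / r_j ≤ t_i / r_i`, that is `u_i ≤ u_j`, a contradiction;
hence all `u_k` agree, and `t` is a multiple of `r`. When they do agree, the users are exchangeable,
which gives `destProb = 1 / K` (`destProb_eq`) and a common value of `b_k / r_k`. As the decisions
are invariant under rescaling `t`, the vector `b(r)` is the only steady state
(`existsUnique_isSteadyState`).

Let `T(n)` converge almost surely to `t`. The mean service need not be continuous at `t`, so `t`
cannot simply be treated as a rest point (and some `t_k` might vanish). But if `u_j < u_i` at `t`,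
then this strict inequality eventually holds along the process, so the comparison, averaged over the
slots, gives `𝔼 T_j(n) / r_j ≤ 𝔼 T_i(n) / r_i + o(1)`. The throughput of user `i` is dominated by
averages of i.i.d. integrable rates, so Fatou's lemma together with the strong law of large numbers
carries this inequality over to `t`, again a contradiction (`IsInput.meanRatio_le_of_tendsto`). So
the `u_k` agree at `t`, also when they are infinite, and the users are exchangeable.

That `destProb` is a conditional probability holds because the throughput before a slot is
independent of that slot (`IsInput.indepFun_throughput`).
-/

namespace JPS.Network

variable {K : ℕ} (N : Network K)

/-! ### The stopping rule -/

instance : IsProbabilityMeasure N.law := N.isProb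

instance : IsProbabilityMeasure N.slotLaw := by
  unfold slotLaw; infer_instance

lemma ratio_eq_meanRatio_mul (t x : Fin K → ℝ≥0) (k : Fin K) :
    N.ratio t x k = N.meanRatio t k * x k := by
  simp only [ratio, meanRatio, ENNReal.coe_mul, div_eq_mul_inv]
  ring

lemma lookAhead_eq (t : Fin K → ℝ≥0) (w : ℝ≥0∞) (k : Fin K) :
    N.lookAhead t w k = ∫⁻ y, max w (N.meanRatio t k * (y : ℝ≥0∞)) ∂N.law := by
  refine lintegral_congr fun y => ?_
  rw [← N.ratio_eq_meanRatio_mul t (fun _ => y) k, ratio]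

lemma remaining_antitone : Antitone N.remaining := by
  intro a b hab
  refine Real.toNNReal_le_toNNReal ?_
  have : (a : ℝ) ≤ b := by exact_mod_cast hab
  nlinarith [N.β_pos]

lemma remaining_le_one (j : ℕ) : N.remaining j ≤ 1 := by
  have := N.remaining_antitone (Nat.zero_le j)
  simpa [remaining] using this

/-- The stopping rule has a threshold form: if probing once more is worth it with a best rate `w'`,
then also with any smaller best rate `w`. The reason is that `𝔼[w' ∨ Y] - w' ≤ 𝔼[w ∨ Y] - w`. -/
lemma continue_of_le {t : Fin K → ℝ≥0} {w w' : ℝ≥0∞} {j : ℕ} {k : Fin K} (hw : w ≤ w')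
    (h : (N.remaining j : ℝ≥0∞) * w' < N.remaining (j + 1) * N.lookAhead t w' k) :
    (N.remaining j : ℝ≥0∞) * w < N.remaining (j + 1) * N.lookAhead t w k := by
  have hrem : (N.remaining (j + 1) : ℝ≥0∞) ≤ N.remaining j := by
    exact_mod_cast N.remaining_antitone (Nat.le_succ j)
  -- `h` excludes the degenerate cases: a used-up slot, and an infinite best rate.
  have hr0 : (N.remaining j : ℝ≥0∞) ≠ 0 := by
    intro h0
    rw [h0] at hrem
    rw [nonpos_iff_eq_zero.1 hrem, zero_mul] at h
    exact not_lt_bot h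
  have hw' : w' ≠ ∞ := by
    rintro rfl
    rw [ENNReal.mul_top hr0] at h
    exact not_top_lt h
  set d := w' - w with hd
  have hdw : w + d = w' := add_tsub_cancel_of_le hw
  have hdtop : d ≠ ∞ := ENNReal.sub_ne_top hw'
  have hL : N.lookAhead t w' k ≤ N.lookAhead t w k + d := by
    calc N.lookAhead t w' k
        ≤ ∫⁻ y, (max w (((N.r k * y : ℝ≥0) : ℝ≥0∞) / t k) + d) ∂N.law := by
          refine lintegral_mono fun y => max_le ?_ ?_
          · rw [← hdw]; gcongr; exact le_max_left _ _
          · exact (le_max_right _ _).trans le_self_add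
      _ = N.lookAhead t w k + d := by
          rw [lintegral_add_right _ measurable_const, lintegral_const, measure_univ, mul_one]
          rfl
  refine lt_of_add_lt_add_right (a := (N.remaining j : ℝ≥0∞) * d) ?_
  calc (N.remaining j : ℝ≥0∞) * w + N.remaining j * d = N.remaining j * w' := by
        rw [← mul_add, hdw]
    _ < N.remaining (j + 1) * N.lookAhead t w' k := h
    _ ≤ N.remaining (j + 1) * (N.lookAhead t w k + d) := by gcongr
    _ ≤ N.remaining (j + 1) * N.lookAhead t w k + N.remaining j * d := by
        rw [mul_add]; gcongr

lemma ratio_le_best {t x : Fin K → ℝ≥0} {σ : Equiv.Perm (Fin K)} {j : ℕ} {l : Fin K}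
    (hl : (l : ℕ) < j) : N.ratio t x (σ l) ≤ N.best t x σ j :=
  le_iSup₂_of_le l hl le_rfl

lemma exists_not_continues (hK : 0 < K) (t x : Fin K → ℝ≥0) (σ : Equiv.Perm (Fin K)) :
    {j | 1 ≤ j ∧ ¬ N.Continues t x σ j}.Nonempty :=
  ⟨K, hK, fun ⟨h, _⟩ => lt_irrefl _ h⟩

lemma numProbes_pos (hK : 0 < K) (t x : Fin K → ℝ≥0) (σ : Equiv.Perm (Fin K)) :
    1 ≤ N.numProbes t x σ :=
  (Nat.sInf_mem (N.exists_not_continues hK t x σ)).1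

lemma not_continues_numProbes (hK : 0 < K) (t x : Fin K → ℝ≥0) (σ : Equiv.Perm (Fin K)) :
    ¬ N.Continues t x σ (N.numProbes t x σ) :=
  (Nat.sInf_mem (N.exists_not_continues hK t x σ)).2

lemma numProbes_le {t x : Fin K → ℝ≥0} {σ : Equiv.Perm (Fin K)} {j : ℕ} (hj : 1 ≤ j)
    (h : ¬ N.Continues t x σ j) : N.numProbes t x σ ≤ j :=
  Nat.sInf_le ⟨hj, h⟩

lemma lt_numProbes_iff (hK : 0 < K) {t x : Fin K → ℝ≥0} {σ : Equiv.Perm (Fin K)} {l : ℕ} :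
    l < N.numProbes t x σ ↔ ∀ m, 1 ≤ m → m ≤ l → N.Continues t x σ m := by
  constructor
  · intro h m hm hml
    by_contra hc
    exact absurd (N.numProbes_le hm hc) (by omega)
  · intro h
    by_contra hc
    exact N.not_continues_numProbes hK t x σ
      (h _ (N.numProbes_pos hK t x σ) (not_lt.1 hc))

/-- Some time for transmission is left: the first probe leaves `1 - β > 0`, and a further probe is
made only if its continuation factor is positive. -/
lemma remaining_numProbes_pos (hK : 0 < K) (t x : Fin K → ℝ≥0) (σ : Equiv.Perm (Fin K)) :
    0 < N.remaining (N.numProbes t x σ) := by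
  have h1 := N.numProbes_pos hK t x σ
  obtain ⟨m, hm⟩ : ∃ m, N.numProbes t x σ = m + 1 := ⟨_, (Nat.sub_add_cancel h1).symm⟩
  rw [hm]
  rcases Nat.eq_zero_or_pos m with rfl | hm0
  · simp [remaining, N.β_lt_one]
  · obtain ⟨_, h⟩ := (N.lt_numProbes_iff hK).1 (by omega : m < N.numProbes t x σ) m hm0 le_rfl
    rw [pos_iff_ne_zero]
    intro h0
    rw [h0, ENNReal.coe_zero, zero_mul] at h
    exact not_lt_bot h

/-! ### The destination -/

lemma IsDest.eq {t x : Fin K → ℝ≥0} {σ : Equiv.Perm (Fin K)} {k k' : Fin K}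
    (h : N.IsDest t x σ k) (h' : N.IsDest t x σ k') : k = k' := by
  obtain ⟨i, rfl, hi, hmax, hfirst⟩ := h
  obtain ⟨i', rfl, hi', hmax', hfirst'⟩ := h'
  rcases lt_trichotomy i i' with hlt | rfl | hlt
  · exact absurd (hfirst' i hlt) (not_lt.2 (hmax i' hi'))
  · rfl
  · exact absurd (hfirst i' hlt) (not_lt.2 (hmax' i hi))

lemma exists_isDest (hK : 0 < K) (t x : Fin K → ℝ≥0) (σ : Equiv.Perm (Fin K)) :
    ∃ k, N.IsDest t x σ k := by
  classical
  set P := Finset.univ.filter fun l : Fin K => (l : ℕ) < N.numProbes t x σ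
  have hP : P.Nonempty := ⟨⟨0, hK⟩, by simpa [P] using Nat.succ_le_iff.1 (N.numProbes_pos hK t x σ)⟩
  obtain ⟨m, hmP, hm⟩ := P.exists_max_image (fun l => N.ratio t x (σ l)) hP
  set Q := P.filter fun l => N.ratio t x (σ l) = N.ratio t x (σ m)
  have hQ : Q.Nonempty := ⟨m, by simp [Q, hmP]⟩
  have hi := Q.min'_mem hQ
  set i := Q.min' hQ
  simp only [Q, P, Finset.mem_filter, Finset.mem_univ, true_and] at hi
  refine ⟨σ i, i, rfl, hi.1, fun l hl => ?_, fun l hl => ?_⟩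
  · rw [hi.2]; exact hm l (by simpa [P] using hl)
  · have hlP : l ∈ P := by
      simp only [P, Finset.mem_filter, Finset.mem_univ, true_and]
      exact lt_trans hl hi.1
    rw [hi.2]
    refine lt_of_le_of_ne (hm l hlP) fun he => ?_
    exact absurd (Q.min'_le l (by simp [Q, hlP, he])) (not_le.2 hl)

lemma service_le (t x : Fin K → ℝ≥0) (σ : Equiv.Perm (Fin K)) (k : Fin K) :
    N.service t x σ k ≤ N.r k * x k := by
  unfold service
  split_ifs
  · exact mul_le_of_le_one_left' (N.remaining_le_one _)
  · exact zero_le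

/-- If nobody receives any service in a slot, then the user probed first has rate zero. -/
lemma rate_first_eq_zero (hK : 0 < K) {t x : Fin K → ℝ≥0}
    {σ : Equiv.Perm (Fin K)} (h : ∀ k, N.service t x σ k = 0) : x (σ ⟨0, hK⟩) = 0 := by
  obtain ⟨k, hk⟩ := N.exists_isDest hK t x σ
  have hx : x k = 0 := by
    have := h k
    rw [service, if_pos hk] at this
    simpa [(N.remaining_numProbes_pos hK t x σ).ne', (N.r_pos k).ne'] using this
  obtain ⟨i, rfl, -, hmax, -⟩ := hk
  have h0 := hmax ⟨0, hK⟩ (N.numProbes_pos hK t x σ)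
  rw [ratio_eq_meanRatio_mul, ratio_eq_meanRatio_mul, hx, ENNReal.coe_zero, mul_zero,
    nonpos_iff_eq_zero, mul_eq_zero] at h0
  rcases h0 with h0 | h0
  · simp [meanRatio, (N.r_pos _).ne'] at h0
  · exact_mod_cast h0

/-! ### Exchanging the rates of two users -/

/-- Let user `σ p` be probed before user `σ q` and have at least the same normalized mean rate.
If `σ q` is the destination, then after exchanging the rates of both users `σ p` is the
destination, and no more users are probed. -/
lemma isDest_swap (hK : 0 < K) {t x : Fin K → ℝ≥0} {σ : Equiv.Perm (Fin K)} {p q : Fin K}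
    (hpq : p < q) (hr : N.meanRatio t (σ q) ≤ N.meanRatio t (σ p))
    (h : N.IsDest t x σ (σ q)) :
    N.IsDest t (x ∘ Equiv.swap (σ p) (σ q)) σ (σ p) ∧
      N.numProbes t (x ∘ Equiv.swap (σ p) (σ q)) σ ≤ N.numProbes t x σ := by
  set x' := x ∘ Equiv.swap (σ p) (σ q) with hx'
  obtain ⟨i, hi, hqJ, hmax, hfirst⟩ := h
  obtain rfl : i = q := σ.injective hi
  have hother : ∀ l, l ≠ p → l ≠ i → N.ratio t x' (σ l) = N.ratio t x (σ l) := by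
    intro l hlp hli
    rw [ratio_eq_meanRatio_mul, ratio_eq_meanRatio_mul, hx', Function.comp_apply,
      Equiv.swap_apply_of_ne_of_ne (σ.injective.ne hlp) (σ.injective.ne hli)]
  have hp : N.ratio t x (σ i) ≤ N.ratio t x' (σ p) := by
    rw [ratio_eq_meanRatio_mul, ratio_eq_meanRatio_mul, hx', Function.comp_apply,
      Equiv.swap_apply_left]
    gcongr
  have hq : N.ratio t x' (σ i) ≤ N.ratio t x (σ p) := by
    rw [ratio_eq_meanRatio_mul, ratio_eq_meanRatio_mul, hx', Function.comp_apply,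
      Equiv.swap_apply_right]
    gcongr
  have hpJ : (p : ℕ) < N.numProbes t x σ := lt_trans hpq hqJ
  -- The best rate at the old stopping time has not decreased, so the probing stops there as well.
  have hle : N.numProbes t x' σ ≤ N.numProbes t x σ := by
    refine N.numProbes_le (N.numProbes_pos hK t x σ) ?_
    rintro ⟨hlt, hc⟩
    refine N.not_continues_numProbes hK t x σ ⟨hlt, N.continue_of_le ?_ hc⟩
    exact iSup₂_le fun l hl => ((hmax l hl).trans hp).trans (N.ratio_le_best hpJ)
  -- Before user `σ p` is probed, the exchange is invisible, so user `σ p` is still probed.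
  have hpJ' : (p : ℕ) < N.numProbes t x' σ := by
    refine (N.lt_numProbes_iff hK).2 fun m hm hmp => ?_
    obtain ⟨hlt, hc⟩ := (N.lt_numProbes_iff hK).1 hpJ m hm hmp
    have hb : N.best t x' σ m = N.best t x σ m := by
      refine iSup_congr fun l => iSup_congr fun hl => hother l ?_ ?_
      · rintro rfl; omega
      · rintro rfl; exact absurd (show (p : ℕ) < l from hpq) (by omega)
    exact ⟨hlt, by rwa [hb]⟩
  refine ⟨⟨p, rfl, hpJ', fun l hl => ?_, fun l hl => ?_⟩, hle⟩
  · by_cases hlp : l = p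
    · rw [hlp]
    by_cases hli : l = i
    · rw [hli]
      exact (hq.trans (hfirst p hpq).le).trans hp
    · rw [hother l hlp hli]
      exact (hmax l (hl.trans_le hle)).trans hp
  · rw [hother l hl.ne (hl.trans hpq).ne]
    exact (hfirst l (hl.trans hpq)).trans_le hp

/-- The probing order is descending in the normalized mean rates. -/
lemma lt_of_meanRatio_lt {t : Fin K → ℝ≥0} {ρ : Equiv.Perm (Fin K)} {p q : Fin K}
    (h : N.meanRatio t (N.order t ρ q) < N.meanRatio t (N.order t ρ p)) : p < q := by
  by_contra hc
  have hm := Tuple.monotone_sort (fun i => OrderDual.toDual (N.meanRatio t (ρ i))) (not_lt.1 hc)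
  exact absurd (OrderDual.toDual_le_toDual.1 hm) (not_le.2 h)

/-- In every outcome of a slot, user `j` has at most the relative service that user `i` has after
the exchange of their rates. -/
lemma service_swap_le (hK : 0 < K) {t : Fin K → ℝ≥0} {i j : Fin K}
    (h : N.meanRatio t j < N.meanRatio t i) (x : Fin K → ℝ≥0) (ρ : Equiv.Perm (Fin K)) :
    N.r i * N.service t x (N.order t ρ) j ≤
      N.r j * N.service t (x ∘ Equiv.swap i j) (N.order t ρ) i := by
  set σ := N.order t ρ with hσ
  by_cases hd : N.IsDest t x σ j
  · obtain ⟨p, rfl⟩ := σ.surjective i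
    obtain ⟨q, rfl⟩ := σ.surjective j
    obtain ⟨hd', hle⟩ := N.isDest_swap hK (N.lt_of_meanRatio_lt h) h.le hd
    rw [service, service, if_pos hd, if_pos hd', Function.comp_apply, Equiv.swap_apply_left,
      mul_left_comm (N.r _), mul_left_comm (N.r (σ q)) (N.remaining _),
      mul_left_comm (N.r (σ p)) (N.r (σ q))]
    gcongr
    exact N.remaining_antitone hle
  · simp [service, hd]

/-! ### Relabelling the users and rescaling the throughput -/

section Relabel

variable {t t' x x' : Fin K → ℝ≥0} {σ σ' : Equiv.Perm (Fin K)} {a : ℝ≥0∞}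

/-- The decisions in a slot only depend on the throughput-normalized rates, listed in the probing
order, up to a common factor `a`. -/
lemma continues_relabel (ha : a ≠ 0) (ha' : a ≠ ∞)
    (ht : ∀ i, N.meanRatio t' (σ' i) = a * N.meanRatio t (σ i)) (hx : ∀ i, x' (σ' i) = x (σ i))
    (j : ℕ) : N.Continues t' x' σ' j ↔ N.Continues t x σ j := by
  have hb : N.best t' x' σ' j = a * N.best t x σ j := by
    simp only [best, ENNReal.mul_iSup, ratio_eq_meanRatio_mul, ht, hx, mul_assoc]
  have hl : ∀ i w, N.lookAhead t' (a * w) (σ' i) = a * N.lookAhead t w (σ i) := by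
    intro i w
    rw [lookAhead_eq, lookAhead_eq, ← lintegral_const_mul' _ _ ha']
    refine lintegral_congr fun y => ?_
    rw [ht, mul_assoc, mul_max]
  unfold Continues
  refine exists_congr fun h => ?_
  rw [hb, hl, mul_left_comm, mul_left_comm _ a, ENNReal.mul_lt_mul_iff_right ha ha']

lemma numProbes_relabel (ha : a ≠ 0) (ha' : a ≠ ∞)
    (ht : ∀ i, N.meanRatio t' (σ' i) = a * N.meanRatio t (σ i)) (hx : ∀ i, x' (σ' i) = x (σ i)) :
    N.numProbes t' x' σ' = N.numProbes t x σ := by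
  simp only [numProbes, N.continues_relabel ha ha' ht hx]

lemma isDest_relabel (ha : a ≠ 0) (ha' : a ≠ ∞)
    (ht : ∀ i, N.meanRatio t' (σ' i) = a * N.meanRatio t (σ i)) (hx : ∀ i, x' (σ' i) = x (σ i))
    (m : Fin K) : N.IsDest t' x' σ' (σ' m) ↔ N.IsDest t x σ (σ m) := by
  simp only [IsDest, EmbeddingLike.apply_eq_iff_eq, exists_eq_left,
    N.numProbes_relabel ha ha' ht hx, ratio_eq_meanRatio_mul, ht, hx, mul_assoc,
    ENNReal.mul_lt_mul_iff_right ha ha', ENNReal.mul_le_mul_iff_right ha ha']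

lemma service_relabel (ha : a ≠ 0) (ha' : a ≠ ∞)
    (ht : ∀ i, N.meanRatio t' (σ' i) = a * N.meanRatio t (σ i)) (hx : ∀ i, x' (σ' i) = x (σ i))
    (m : Fin K) :
    N.r (σ m) * N.service t' x' σ' (σ' m) = N.r (σ' m) * N.service t x σ (σ m) := by
  have hd := N.isDest_relabel ha ha' ht hx m
  simp only [service, N.numProbes_relabel ha ha' ht hx, hx]
  by_cases h : N.IsDest t x σ (σ m)
  · rw [if_pos h, if_pos (hd.2 h)]; ring
  · rw [if_neg h, if_neg (mt hd.1 h)]; simp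

end Relabel

/-! ### Measurability of one slot -/

instance : DiscreteMeasurableSpace (Equiv.Perm (Fin K)) := ⟨fun _ => trivial⟩

lemma measurable_ratio (k : Fin K) :
    Measurable fun p : (Fin K → ℝ≥0) × (Fin K → ℝ≥0) => N.ratio p.1 p.2 k := by
  unfold ratio; fun_prop

lemma measurable_meanRatio (k : Fin K) : Measurable fun t : Fin K → ℝ≥0 => N.meanRatio t k := by
  unfold meanRatio; fun_prop

lemma continuous_meanRatio (k : Fin K) : Continuous fun t => N.meanRatio t k := by
  simp only [meanRatio, div_eq_mul_inv]
  exact (ENNReal.continuous_const_mul ENNReal.coe_ne_top).comp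
    (continuous_inv.comp (ENNReal.continuous_coe.comp (continuous_apply k)))

lemma measurable_best (σ : Equiv.Perm (Fin K)) (j : ℕ) :
    Measurable fun p : (Fin K → ℝ≥0) × (Fin K → ℝ≥0) => N.best p.1 p.2 σ j :=
  .iSup fun i => .iSup fun _ => N.measurable_ratio (σ i)

lemma measurable_lookAhead (k : Fin K) :
    Measurable fun p : (Fin K → ℝ≥0) × ℝ≥0∞ => N.lookAhead p.1 p.2 k := by
  unfold lookAhead
  refine Measurable.lintegral_prod_right'
    (f := fun q : ((Fin K → ℝ≥0) × ℝ≥0∞) × ℝ≥0 =>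
      max q.1.2 (((N.r k * q.2 : ℝ≥0) : ℝ≥0∞) / q.1.1 k)) ?_
  fun_prop

lemma measurableSet_continues (σ : Equiv.Perm (Fin K)) (j : ℕ) :
    MeasurableSet {p : (Fin K → ℝ≥0) × (Fin K → ℝ≥0) | N.Continues p.1 p.2 σ j} := by
  unfold Continues
  by_cases h : j < K
  · simp only [h, exists_true_left]
    refine measurableSet_lt ((N.measurable_best σ j).const_mul _) (Measurable.const_mul ?_ _)
    exact (N.measurable_lookAhead _).comp (measurable_fst.prodMk (N.measurable_best σ j))
  · simp [h]

lemma measurable_numProbes (hK : 0 < K) (σ : Equiv.Perm (Fin K)) :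
    Measurable fun p : (Fin K → ℝ≥0) × (Fin K → ℝ≥0) => N.numProbes p.1 p.2 σ := by
  refine measurable_of_Ioi fun l => ?_
  have : (fun p : (Fin K → ℝ≥0) × (Fin K → ℝ≥0) => N.numProbes p.1 p.2 σ) ⁻¹' Set.Ioi l =
      {p | ∀ m, 1 ≤ m → m ≤ l → N.Continues p.1 p.2 σ m} :=
    Set.ext fun p => N.lt_numProbes_iff hK
  rw [this]
  have hc := fun m => measurableSet_setOfPred.1 (N.measurableSet_continues σ m)
  exact measurableSet_setOfPred.2
    (.forall fun m => .imp measurable_const (.imp measurable_const (hc m)))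

lemma measurableSet_isDest (hK : 0 < K) (σ : Equiv.Perm (Fin K)) (k : Fin K) :
    MeasurableSet {p : (Fin K → ℝ≥0) × (Fin K → ℝ≥0) | N.IsDest p.1 p.2 σ k} := by
  have hn := N.measurable_numProbes hK σ
  have hr := N.measurable_ratio
  have hlt : ∀ a : ℕ, Measurable
      fun p : (Fin K → ℝ≥0) × (Fin K → ℝ≥0) => a < N.numProbes p.1 p.2 σ :=
    fun a => measurableSet_setOfPred.1 (measurableSet_lt measurable_const hn)
  refine measurableSet_setOfPred.2
    (.exists fun i => .and measurable_const (.and (hlt i) (.and ?_ ?_)))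
  · exact .forall fun l => .imp (hlt l) (measurableSet_setOfPred.1 (measurableSet_le (hr _) (hr _)))
  · exact .forall fun l => .imp measurable_const
      (measurableSet_setOfPred.1 (measurableSet_lt (hr _) (hr _)))

lemma measurable_order :
    Measurable fun p : (Fin K → ℝ≥0) × Equiv.Perm (Fin K) => N.order p.1 p.2 := by
  refine measurable_from_prod_countable_left fun ρ => measurable_to_countable' fun σ => ?_
  have h : (fun t => N.order t ρ) ⁻¹' {σ} = {t | (∀ a b, a ≤ b →
      N.meanRatio t (σ b) ≤ N.meanRatio t (σ a)) ∧ ∀ a b, a < b →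
        N.meanRatio t (σ a) = N.meanRatio t (σ b) → ρ.symm (σ a) < ρ.symm (σ b)} := by
    ext t
    have h1 : N.order t ρ = σ ↔ σ.trans ρ.symm =
        Tuple.sort fun i => OrderDual.toDual (N.meanRatio t (ρ i)) := by
      unfold order
      constructor
      · rintro rfl; ext; simp
      · intro h; rw [← h]; ext; simp
    rw [Set.mem_preimage, Set.mem_singleton_iff, h1, Tuple.eq_sort_iff]
    simp [Monotone]
  have hm := N.measurable_meanRatio
  rw [h]
  refine measurableSet_setOfPred.2 (.and ?_ ?_)
  · exact .forall fun a => .forall fun b => .imp measurable_const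
      (measurableSet_setOfPred.1 (measurableSet_le (hm _) (hm _)))
  · exact .forall fun a => .forall fun b => .imp measurable_const (.imp
      (measurableSet_setOfPred.1 (measurableSet_eq_fun (hm _) (hm _))) measurable_const)

lemma measurable_isDest_order (hK : 0 < K) (k : Fin K) :
    Measurable fun z : (Fin K → ℝ≥0) × ((Fin K → ℝ≥0) × Equiv.Perm (Fin K)) =>
      N.IsDest z.1 z.2.1 (N.order z.1 z.2.2) k := by
  have h : Measurable fun q : ((Fin K → ℝ≥0) × (Fin K → ℝ≥0)) × Equiv.Perm (Fin K) =>
      N.IsDest q.1.1 q.1.2 q.2 k :=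
    measurable_from_prod_countable_left fun σ =>
      measurableSet_setOfPred.1 (N.measurableSet_isDest hK σ k)
  have ho := N.measurable_order
  exact h.comp (g := _) (f := fun z : (Fin K → ℝ≥0) × ((Fin K → ℝ≥0) × Equiv.Perm (Fin K)) =>
    ((z.1, z.2.1), N.order z.1 z.2.2)) (by fun_prop)

lemma measurable_service_order (hK : 0 < K) (k : Fin K) :
    Measurable fun z : (Fin K → ℝ≥0) × ((Fin K → ℝ≥0) × Equiv.Perm (Fin K)) =>
      N.service z.1 z.2.1 (N.order z.1 z.2.2) k := by
  have h : Measurable fun q : ((Fin K → ℝ≥0) × (Fin K → ℝ≥0)) × Equiv.Perm (Fin K) =>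
      N.service q.1.1 q.1.2 q.2 k := by
    refine measurable_from_prod_countable_left fun σ => ?_
    refine Measurable.ite (N.measurableSet_isDest hK σ k) ?_ measurable_const
    have hrem : Measurable N.remaining := measurable_from_nat
    exact (hrem.comp (N.measurable_numProbes hK σ)).mul (by fun_prop)
  have ho := N.measurable_order
  exact h.comp (g := _) (f := fun z : (Fin K → ℝ≥0) × ((Fin K → ℝ≥0) × Equiv.Perm (Fin K)) =>
    ((z.1, z.2.1), N.order z.1 z.2.2)) (by fun_prop)

lemma measurable_service (hK : 0 < K) (t : Fin K → ℝ≥0) (k : Fin K) :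
    Measurable fun z : (Fin K → ℝ≥0) × Equiv.Perm (Fin K) =>
      N.service t z.1 (N.order t z.2) k := by
  have h := (N.measurable_service_order hK k).comp (measurable_prodMk_left (x := t))
  exact h

lemma measurableSet_isDest_slot (hK : 0 < K) (t : Fin K → ℝ≥0) (k : Fin K) :
    MeasurableSet {z : (Fin K → ℝ≥0) × Equiv.Perm (Fin K) | N.IsDest t z.1 (N.order t z.2) k} := by
  have h := (N.measurable_isDest_order hK k).comp (measurable_prodMk_left (x := t))
  exact measurableSet_setOfPred.2 h

lemma measurable_destProb (hK : 0 < K) (k : Fin K) : Measurable fun t => N.destProb t k :=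
  measurable_measure_prodMk_left (measurableSet_setOfPred.2 (N.measurable_isDest_order hK k))

lemma measurable_meanService (hK : 0 < K) (k : Fin K) : Measurable fun t => N.meanService t k :=
  Measurable.lintegral_prod_right' (N.measurable_service_order hK k).coe_nnreal_ennreal

/-! ### Symmetries of the law of one slot -/

/-- The law of a slot does not change if the users are relabelled, for the rates by `π` and for the
shuffle by any `τ`. -/
lemma measurePreserving_relabel (π τ : Equiv.Perm (Fin K)) :
    MeasurePreserving (fun z : (Fin K → ℝ≥0) × Equiv.Perm (Fin K) => (z.1 ∘ π, z.2.trans τ))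
      N.slotLaw N.slotLaw := by
  have h1 : MeasurePreserving (fun x : Fin K → ℝ≥0 => x ∘ π)
      (Measure.pi fun _ => N.law) (Measure.pi fun _ => N.law) := by
    convert measurePreserving_piCongrLeft (fun _ : Fin K => N.law) π.symm using 1
    ext x i
    simp [MeasurableEquiv.piCongrLeft, Equiv.piCongrLeft]
  have h2 : MeasurePreserving (fun ρ : Equiv.Perm (Fin K) => ρ.trans τ)
      (PMF.uniformOfFintype (Equiv.Perm (Fin K))).toMeasure
      (PMF.uniformOfFintype (Equiv.Perm (Fin K))).toMeasure := by
    refine ⟨measurable_of_finite _, Measure.ext_of_singleton fun σ => ?_⟩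
    have : (fun ρ : Equiv.Perm (Fin K) => ρ.trans τ) ⁻¹' {σ} = {σ.trans τ.symm} := by
      ext ρ
      simp only [Set.mem_preimage, Set.mem_singleton_iff]
      constructor
      · rintro rfl; ext; simp
      · rintro rfl; ext; simp
    rw [Measure.map_apply (measurable_of_finite _) (measurableSet_singleton _), this]
    simp
  exact h1.prod h2

lemma measurePreserving_rate (k : Fin K) :
    MeasurePreserving (fun z : (Fin K → ℝ≥0) × Equiv.Perm (Fin K) => z.1 k) N.slotLaw N.law :=
  (measurePreserving_eval (fun _ : Fin K => N.law) k).comp measurePreserving_fst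

lemma lintegral_rate (k : Fin K) : ∫⁻ z, (z.1 k : ℝ≥0∞) ∂N.slotLaw = 1 := by
  rw [← N.mean_one]
  exact (N.measurePreserving_rate k).lintegral_comp
    (f := fun x : ℝ≥0 => (x : ℝ≥0∞)) measurable_coe_nnreal_ennreal

lemma meanService_le (t : Fin K → ℝ≥0) (k : Fin K) : N.meanService t k ≤ N.r k := by
  calc N.meanService t k ≤ ∫⁻ z, (N.r k : ℝ≥0∞) * z.1 k ∂N.slotLaw := by
        refine lintegral_mono fun z => ?_
        rw [← ENNReal.coe_mul, ENNReal.coe_le_coe]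
        exact N.service_le t z.1 (N.order t z.2) k
    _ = N.r k := by
        rw [lintegral_const_mul' _ _ ENNReal.coe_ne_top, lintegral_rate, mul_one]

/-- A user with a larger normalized mean rate has at least the same relative mean service. -/
lemma meanService_mul_le (hK : 0 < K) {t : Fin K → ℝ≥0} {i j : Fin K}
    (h : N.meanRatio t j < N.meanRatio t i) :
    N.r i * N.meanService t j ≤ N.r j * N.meanService t i := by
  unfold meanService
  rw [← (N.measurePreserving_relabel (Equiv.swap i j) (Equiv.refl _)).lintegral_comp
    (N.measurable_service hK t i).coe_nnreal_ennreal,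
    ← lintegral_const_mul' _ _ ENNReal.coe_ne_top, ← lintegral_const_mul' _ _ ENNReal.coe_ne_top]
  refine lintegral_mono fun z => ?_
  rw [← ENNReal.coe_mul, ← ENNReal.coe_mul, ENNReal.coe_le_coe]
  exact N.service_swap_le hK h z.1 z.2

/-! ### Equal normalized mean rates -/

lemma order_eq_self {t : Fin K → ℝ≥0} (h : ∀ i j, N.meanRatio t i = N.meanRatio t j)
    (ρ : Equiv.Perm (Fin K)) : N.order t ρ = ρ := by
  unfold order
  rw [Tuple.sort_eq_refl_iff_monotone.2 fun a b _ => (congrArg _ (h _ _)).le, Equiv.refl_trans]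

lemma destProb_eq_destProb (hK : 0 < K) {t : Fin K → ℝ≥0}
    (h : ∀ i j, N.meanRatio t i = N.meanRatio t j) (k k' : Fin K) :
    N.destProb t k = N.destProb t k' := by
  unfold destProb
  rw [← (N.measurePreserving_relabel (Equiv.swap k k') (Equiv.swap k k')).measure_preimage
    (N.measurableSet_isDest_slot hK t k').nullMeasurableSet]
  congr 1
  ext ⟨x, ρ⟩
  simp only [N.order_eq_self h, Set.mem_ofPred_eq, Set.preimage_ofPred_eq]
  obtain ⟨m, rfl⟩ := ρ.surjective k
  have := N.isDest_relabel (t := t) (t' := t) (x := x) (x' := x ∘ Equiv.swap (ρ m) k') (σ := ρ)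
    (σ' := ρ.trans (Equiv.swap (ρ m) k')) one_ne_zero ENNReal.one_ne_top
    (fun i => by rw [one_mul]; exact h _ _) (fun i => by simp) m
  simpa using this.symm

/-- If all normalized mean rates agree, the users are exchangeable. -/
lemma destProb_eq (hK : 0 < K) {t : Fin K → ℝ≥0} (h : ∀ i j, N.meanRatio t i = N.meanRatio t j)
    (k : Fin K) : N.destProb t k = 1 / (K : ℝ≥0∞) := by
  have hsum : ∑ l, N.destProb t l = 1 := by
    unfold destProb
    rw [← measure_biUnion_finset, ← measure_univ (μ := N.slotLaw)]
    · congr 1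
      refine Set.eq_univ_of_forall fun z => ?_
      obtain ⟨l, hl⟩ := N.exists_isDest hK t z.1 (N.order t z.2)
      exact Set.mem_biUnion (Finset.mem_coe.2 (Finset.mem_univ l)) hl
    · intro l _ l' _ hne
      exact Set.disjoint_left.2 fun z hz hz' => hne (IsDest.eq N hz hz')
    · exact fun l _ => N.measurableSet_isDest_slot hK t l
  rw [Finset.sum_congr rfl fun l _ => N.destProb_eq_destProb hK h l k, Finset.sum_const,
    Finset.card_univ, Fintype.card_fin, nsmul_eq_mul] at hsum
  exact ENNReal.eq_div_iff (by exact_mod_cast hK.ne') (ENNReal.natCast_ne_top K) |>.2 hsum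

/-- If all normalized mean rates agree, then all users have the same relative mean service. -/
lemma meanService_mul_eq (hK : 0 < K) {t : Fin K → ℝ≥0}
    (h : ∀ i j, N.meanRatio t i = N.meanRatio t j) (k k' : Fin K) :
    N.r k * N.meanService t k' = N.r k' * N.meanService t k := by
  unfold meanService
  rw [← (N.measurePreserving_relabel (Equiv.swap k k') (Equiv.swap k k')).lintegral_comp
    (N.measurable_service hK t k').coe_nnreal_ennreal,
    ← lintegral_const_mul' _ _ ENNReal.coe_ne_top, ← lintegral_const_mul' _ _ ENNReal.coe_ne_top]
  refine lintegral_congr fun ⟨x, ρ⟩ => ?_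
  simp only [N.order_eq_self h]
  obtain ⟨m, rfl⟩ := ρ.surjective k
  have := N.service_relabel (t := t) (t' := t) (x := x) (x' := x ∘ Equiv.swap (ρ m) k') (σ := ρ)
    (σ' := ρ.trans (Equiv.swap (ρ m) k')) one_ne_zero ENNReal.one_ne_top
    (fun i => by rw [one_mul]; exact h _ _) (fun i => by simp) m
  simp only [Equiv.trans_apply, Equiv.swap_apply_left] at this
  rw [← ENNReal.coe_mul, ← ENNReal.coe_mul, ENNReal.coe_inj]
  exact this

lemma meanRatio_r (k : Fin K) : N.meanRatio N.r k = 1 :=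
  ENNReal.div_self (by exact_mod_cast (N.r_pos k).ne') ENNReal.coe_ne_top

/-- When all normalized mean rates agree, the mean service does not depend on their value. -/
lemma meanService_eq_of_meanRatio_eq {t : Fin K → ℝ≥0} {a : ℝ≥0∞} (ha : a ≠ 0) (ha' : a ≠ ∞)
    (h : ∀ k, N.meanRatio t k = a) (k : Fin K) : N.meanService t k = N.meanService N.r k := by
  unfold meanService
  refine lintegral_congr fun ⟨x, ρ⟩ => ?_
  simp only [N.order_eq_self (t := t) (fun i j => (h i).trans (h j).symm),
    N.order_eq_self (t := N.r) (fun i j => by simp only [meanRatio_r])]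
  obtain ⟨m, rfl⟩ := ρ.surjective k
  have := N.service_relabel (t := N.r) (t' := t) (x := x) (x' := x) (σ := ρ)
    (σ' := ρ) ha ha' (fun i => by rw [h, meanRatio_r, mul_one]) (fun i => rfl) m
  rw [mul_left_cancel₀ (N.r_pos _).ne' this]

/-- At `t = r`, if one user had no mean service, then by symmetry none would have any, and the
user probed first would have rate zero almost surely, against its mean one. -/
lemma meanService_r_ne_zero (hK : 0 < K) (k : Fin K) : N.meanService N.r k ≠ 0 := by
  intro h0
  have hall : ∀ l, N.meanService N.r l = 0 := by
    intro l
    have := N.meanService_mul_eq hK (t := N.r) (fun i j => by simp only [meanRatio_r]) k l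
    rw [h0, mul_zero, mul_eq_zero] at this
    exact this.resolve_left (by exact_mod_cast (N.r_pos k).ne')
  have hae : ∀ᵐ z ∂N.slotLaw, ∀ l, N.service N.r z.1 (N.order N.r z.2) l = 0 := by
    refine ae_all_iff.2 fun l => ?_
    filter_upwards [(lintegral_eq_zero_iff
      (N.measurable_service hK N.r l).coe_nnreal_ennreal).1 (hall l)] with z hz
    exact ENNReal.coe_eq_zero.1 hz
  have hfirst : ∫⁻ z, (z.1 (z.2 ⟨0, hK⟩) : ℝ≥0∞) ∂N.slotLaw = 1 := by
    unfold slotLaw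
    rw [lintegral_prod_symm]
    · have : ∀ ρ : Equiv.Perm (Fin K),
          ∫⁻ x, (x (ρ ⟨0, hK⟩) : ℝ≥0∞) ∂(Measure.pi fun _ : Fin K => N.law) = 1 := by
        intro ρ
        rw [← N.mean_one]
        exact (measurePreserving_eval (fun _ : Fin K => N.law) (ρ ⟨0, hK⟩)).lintegral_comp
          (f := fun x : ℝ≥0 => (x : ℝ≥0∞)) measurable_coe_nnreal_ennreal
      simp [this]
    · refine Measurable.aemeasurable (measurable_from_prod_countable_left fun ρ => ?_)
      exact (measurable_pi_apply (ρ ⟨0, hK⟩)).coe_nnreal_ennreal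
  have hzero : ∫⁻ z, (z.1 (z.2 ⟨0, hK⟩) : ℝ≥0∞) ∂N.slotLaw = 0 := by
    rw [← lintegral_zero (μ := N.slotLaw)]
    refine lintegral_congr_ae ?_
    filter_upwards [hae] with z hz
    have := N.rate_first_eq_zero hK hz
    rw [N.order_eq_self (t := N.r) (fun i j => by simp only [meanRatio_r])] at this
    rw [this, ENNReal.coe_zero]
  exact one_ne_zero (hfirst.symm.trans hzero)

/-! ### Steady states -/

/-- At a steady state the throughput vector is a multiple of the vector of mean rates. -/
lemma IsSteadyState.meanRatio_eq (hK : 0 < K) {t : Fin K → ℝ≥0} (ht : N.IsSteadyState t)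
    (i j : Fin K) : N.meanRatio t i = N.meanRatio t j := by
  have key : ∀ i j, N.meanRatio t i ≤ N.meanRatio t j := by
    intro i j
    by_contra! h
    have := N.meanService_mul_le hK h
    rw [ht.2 i, ht.2 j] at this
    refine absurd h (not_lt.2 ?_)
    unfold meanRatio
    rw [ENNReal.div_le_iff (by exact_mod_cast (ht.1 i).ne') ENNReal.coe_ne_top,
      ← ENNReal.mul_div_right_comm,
      ENNReal.le_div_iff_mul_le (by simp [(ht.1 j).ne']) (by simp)]
    exact this
  exact le_antisymm (key i j) (key j i)

lemma existsUnique_isSteadyState (hK : 0 < K) : ∃! t : Fin K → ℝ≥0, N.IsSteadyState t := by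
  have hr : ∀ i j, N.meanRatio N.r i = N.meanRatio N.r j := fun i j => by simp only [meanRatio_r]
  have htop : ∀ k, N.meanService N.r k ≠ ∞ := fun k =>
    ne_top_of_le_ne_top ENNReal.coe_ne_top (N.meanService_le N.r k)
  have hne := N.meanService_r_ne_zero hK
  have hrne : ∀ k, (N.r k : ℝ≥0∞) ≠ 0 := fun k => by exact_mod_cast (N.r_pos k).ne'
  set t : Fin K → ℝ≥0 := fun k => (N.meanService N.r k).toNNReal with ht
  have htk : ∀ k, (t k : ℝ≥0∞) = N.meanService N.r k := fun k => ENNReal.coe_toNNReal (htop k)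
  refine ⟨t, ⟨fun k => ENNReal.toNNReal_pos (hne k) (htop k), fun k => ?_⟩, fun s hs => ?_⟩
  · set k₀ : Fin K := ⟨0, hK⟩
    have hc : ∀ l, N.meanRatio t l = N.meanRatio t k₀ := by
      intro l
      unfold meanRatio
      rw [htk, htk, ENNReal.div_eq_div_iff (hne _) (htop _) (hne _) (htop _), mul_comm,
        mul_comm (N.meanService N.r l), N.meanService_mul_eq hK hr]
    rw [htk, N.meanService_eq_of_meanRatio_eq (ENNReal.div_ne_zero.2 ⟨hrne _, by simp⟩)
      (ENNReal.div_ne_top ENNReal.coe_ne_top (by rw [htk]; exact hne _)) hc]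
  · funext k
    have := N.meanService_eq_of_meanRatio_eq (a := N.meanRatio s k)
      (ENNReal.div_ne_zero.2 ⟨hrne _, by simp⟩)
      (ENNReal.div_ne_top ENNReal.coe_ne_top (by exact_mod_cast (hs.1 _).ne'))
      (fun l => IsSteadyState.meanRatio_eq N hK hs l k) k
    rw [hs.2 k, ← htk] at this
    exact_mod_cast this

/-! ### The throughput process -/

section ThroughputProcess

variable {Ω : Type*} {X : ℕ → Fin K → Ω → ℝ≥0} {ρ : ℕ → Ω → Equiv.Perm (Fin K)}

/-- The randomness of slot `n + 1`: the normalized rates of all users, and the shuffle. -/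
def slot (X : ℕ → Fin K → Ω → ℝ≥0) (ρ : ℕ → Ω → Equiv.Perm (Fin K)) (n : ℕ) (ω : Ω) :
    (Fin K → ℝ≥0) × Equiv.Perm (Fin K) :=
  ((fun k => X n k ω), ρ n ω)

/-- The service `B_k(n + 1)` of user `k` in slot `n + 1`. -/
noncomputable def slotService (X : ℕ → Fin K → Ω → ℝ≥0) (ρ : ℕ → Ω → Equiv.Perm (Fin K))
    (k : Fin K) (n : ℕ) (ω : Ω) : ℝ≥0 :=
  N.service (N.throughput X ρ n ω) (slot X ρ n ω).1
    (N.order (N.throughput X ρ n ω) (slot X ρ n ω).2) k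

/-- The throughput is the average service; the initial value `1` is forgotten after one slot. -/
lemma throughput_eq_div {n : ℕ} (hn : n ≠ 0) (k : Fin K) (ω : Ω) :
    N.throughput X ρ n ω k = (∑ m ∈ Finset.range n, N.slotService X ρ k m ω) / n := by
  have h : ∀ n : ℕ, (n : ℝ≥0) * N.throughput X ρ n ω k =
      ∑ m ∈ Finset.range n, N.slotService X ρ k m ω := by
    intro n
    induction n with
    | zero => simp
    | succ n ih =>
      rw [Finset.sum_range_succ, ← ih]
      have : (n : ℝ≥0) + 1 ≠ 0 := by positivity
      simp only [throughput, slotService, slot]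
      push_cast
      field_simp
  rw [← h, mul_div_cancel_left₀ _ (by exact_mod_cast hn)]

/-- The throughput after `n` slots is a measurable function of the first `n` slots. The
`σ`-algebra on `Ω` is arbitrary, so that it may be the one generated by these slots. -/
lemma measurable_throughput [MeasurableSpace Ω] (hK : 0 < K) (n : ℕ)
    (h : ∀ i < n, Measurable (slot X ρ i)) : Measurable (N.throughput X ρ n) := by
  induction n with
  | zero => exact measurable_const
  | succ n ih =>
    have hT := ih fun i hi => h i (by omega)
    have hs := h n (by omega)
    refine measurable_pi_iff.2 fun k => ?_
    have hB := (N.measurable_service_order hK k).comp (hT.prodMk hs)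
    have hTk := (measurable_pi_apply k).comp hT
    exact (hTk.const_mul _).add (hB.const_mul _)

variable [MeasurableSpace Ω] {μ : Measure Ω}

lemma IsInput.measurable_slot (hin : N.IsInput μ X ρ) (n : ℕ) : Measurable (slot X ρ n) :=
  (measurable_pi_iff.2 fun k => hin.measurable_rate n k).prodMk (hin.measurable_shuffle n)

lemma IsInput.measurable_throughput (hK : 0 < K) (hin : N.IsInput μ X ρ) (n : ℕ) :
    Measurable (N.throughput X ρ n) :=
  N.measurable_throughput hK n fun i _ => IsInput.measurable_slot N hin i

lemma IsInput.measurable_slotService (hK : 0 < K) (hin : N.IsInput μ X ρ) (k : Fin K) (n : ℕ) :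
    Measurable (N.slotService X ρ k n) := by
  have h := (N.measurable_service_order hK k).comp
    ((IsInput.measurable_throughput N hK hin n).prodMk (IsInput.measurable_slot N hin n))
  exact h

lemma IsInput.measurePreserving_slot (hin : N.IsInput μ X ρ) (n : ℕ) :
    MeasurePreserving (slot X ρ n) μ N.slotLaw :=
  ⟨IsInput.measurable_slot N hin n, hin.law_slot n⟩

/-- The throughput before a slot is independent of the slot. -/
lemma IsInput.indepFun_throughput (hK : 0 < K) (hin : N.IsInput μ X ρ) (n : ℕ) :
    IndepFun (N.throughput X ρ n) (slot X ρ n) μ := by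
  have hindep := indep_iSup_of_disjoint
    (m := fun i => MeasurableSpace.comap (slot X ρ i) inferInstance)
    (fun i => (IsInput.measurable_slot N hin i).comap_le) hin.indep.iIndep
    (S := Set.Iio n) (T := {n}) (by simp)
  rw [IndepFun_iff_Indep]
  refine indep_of_indep_of_le_left (indep_of_indep_of_le_right hindep ?_) ?_
  · exact le_iSup₂_of_le n rfl le_rfl
  · refine Measurable.comap_le ?_
    refine @JPS.Network.measurable_throughput K N Ω X ρ (_) hK n fun i hi => ?_
    exact Measurable.of_comap_le (le_iSup₂_of_le (f := fun i (_ : i ∈ Set.Iio n) =>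
      MeasurableSpace.comap (slot X ρ i) inferInstance) i hi le_rfl)

lemma IsInput.measurableSet_destEvent (hK : 0 < K) (hin : N.IsInput μ X ρ) (n : ℕ) (k : Fin K) :
    MeasurableSet (N.destEvent X ρ n k) :=
  ((IsInput.measurable_throughput N hK hin n).prodMk (IsInput.measurable_slot N hin n))
    (measurableSet_setOfPred.2 (N.measurable_isDest_order hK k))

lemma IsInput.lintegral_rate (hin : N.IsInput μ X ρ) (k : Fin K) (n : ℕ) :
    ∫⁻ ω, X n k ω ∂μ = 1 := by
  rw [← N.lintegral_rate k]
  exact (IsInput.measurePreserving_slot N hin n).lintegral_comp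
    (f := fun z => (z.1 k : ℝ≥0∞)) (by fun_prop)

/-- The strong law of large numbers for the normalized rates. -/
lemma IsInput.tendsto_average_rate (hin : N.IsInput μ X ρ) (k : Fin K) :
    ∀ᵐ ω ∂μ, Tendsto (fun n : ℕ => (∑ m ∈ Finset.range n, X m k ω) / n) atTop (𝓝 1) := by
  have hmeas := fun n => hin.measurable_rate n k
  have hpres : ∀ n, MeasurePreserving (X n k) μ N.law := fun n =>
    (N.measurePreserving_rate k).comp (IsInput.measurePreserving_slot N hin n)
  have hlaw := strong_law_ae_real (μ := μ) (fun n ω => (X n k ω : ℝ)) ?_ ?_ ?_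
  · have hmean : ∫ ω, (X 0 k ω : ℝ) ∂μ = 1 := by
      rw [integral_eq_lintegral_of_nonneg_ae (.of_forall fun ω => NNReal.coe_nonneg _)
        (hmeas 0).coe_nnreal_real.aestronglyMeasurable]
      simp [IsInput.lintegral_rate N hin]
    filter_upwards [hlaw] with ω hω
    rw [hmean] at hω
    rw [← NNReal.tendsto_coe]
    push_cast
    exact hω
  · refine ⟨(hmeas 0).coe_nnreal_real.aestronglyMeasurable, ?_⟩
    simp [HasFiniteIntegral, IsInput.lintegral_rate N hin]
  · intro i j hij
    have hf : Measurable fun z : (Fin K → ℝ≥0) × Equiv.Perm (Fin K) => (z.1 k : ℝ) := by fun_prop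
    exact (hin.indep.indepFun hij).comp hf hf
  · intro i
    have h : IdentDistrib (X i k) (X 0 k) μ μ := ⟨(hmeas i).aemeasurable, (hmeas 0).aemeasurable,
      (hpres i).map_eq.trans (hpres 0).map_eq.symm⟩
    exact h.comp measurable_coe_nnreal_real

variable [IsProbabilityMeasure μ]

lemma IsInput.map_throughput_slot (hK : 0 < K) (hin : N.IsInput μ X ρ) (n : ℕ) :
    μ.map (fun ω => (N.throughput X ρ n ω, slot X ρ n ω)) =
      (μ.map (N.throughput X ρ n)).prod N.slotLaw := by
  rw [(indepFun_iff_map_prod_eq_prod_map_map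
    (IsInput.measurable_throughput N hK hin n).aemeasurable
    (IsInput.measurable_slot N hin n).aemeasurable).1 (IsInput.indepFun_throughput N hK hin n),
    (IsInput.measurePreserving_slot N hin n).map_eq]

lemma IsInput.setLIntegral_destProb (hK : 0 < K) (hin : N.IsInput μ X ρ) (n : ℕ) (k : Fin K)
    {s : Set (Fin K → ℝ≥0)} (hs : MeasurableSet s) :
    ∫⁻ ω in N.throughput X ρ n ⁻¹' s, N.destProb (N.throughput X ρ n ω) k ∂μ =
      μ (N.destEvent X ρ n k ∩ N.throughput X ρ n ⁻¹' s) := by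
  have hT := IsInput.measurable_throughput N hK hin n
  have hD := measurableSet_setOfPred.2 (N.measurable_isDest_order hK k)
  have hC := hD.inter (measurable_fst hs)
  have h1 : μ (N.destEvent X ρ n k ∩ N.throughput X ρ n ⁻¹' s) =
      μ.map (fun ω => (N.throughput X ρ n ω, slot X ρ n ω)) _ :=
    (Measure.map_apply (hT.prodMk (IsInput.measurable_slot N hin n)) hC).symm
  rw [h1, IsInput.map_throughput_slot N hK hin, Measure.prod_apply hC,
    ← setLIntegral_map hs (N.measurable_destProb hK k) hT, ← lintegral_indicator hs]
  refine lintegral_congr fun t => ?_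
  by_cases ht : t ∈ s
  · rw [Set.indicator_of_mem ht, destProb]
    congr 1
    ext z
    simp [ht]
  · rw [Set.indicator_of_notMem ht, ← measure_empty (μ := N.slotLaw)]
    congr 1
    ext z
    simp [ht]

/-- `destProb` is a version of the conditional probability of being the destination. -/
lemma IsInput.condExp_destEvent (hK : 0 < K) (hin : N.IsInput μ X ρ) (n : ℕ) (k : Fin K) :
    μ[(N.destEvent X ρ n k).indicator (fun _ => (1 : ℝ)) |
        MeasurableSpace.comap (N.throughput X ρ n) inferInstance]
      =ᵐ[μ] fun ω => (N.destProb (N.throughput X ρ n ω) k).toReal := by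
  have hT := IsInput.measurable_throughput N hK hin n
  have hE := IsInput.measurableSet_destEvent N hK hin n k
  have hp := N.measurable_destProb hK k
  have hle : ∀ t, N.destProb t k ≤ 1 := fun t => prob_le_one
  have hm : Measurable[MeasurableSpace.comap (N.throughput X ρ n) inferInstance]
      fun ω => (N.destProb (N.throughput X ρ n ω) k).toReal :=
    hp.ennreal_toReal.comp (comap_measurable _)
  symm
  refine ae_eq_condExp_of_forall_setIntegral_eq hT.comap_le
    ((integrable_const 1).indicator hE) ?_ ?_ hm.aestronglyMeasurable
  · intro s _ _
    refine Integrable.integrableOn (Integrable.of_bound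
      (hp.ennreal_toReal.comp hT).aestronglyMeasurable 1 (.of_forall fun ω => ?_))
    rw [Real.norm_of_nonneg ENNReal.toReal_nonneg]
    exact ENNReal.toReal_le_of_le_ofReal zero_le_one (by simpa using hle _)
  · rintro _ ⟨s, hs, rfl⟩ _
    have hp' : AEMeasurable (fun ω => N.destProb (N.throughput X ρ n ω) k)
        (μ.restrict (N.throughput X ρ n ⁻¹' s)) := (hp.comp hT).aemeasurable
    rw [integral_toReal hp' (.of_forall fun ω => (hle _).trans_lt ENNReal.one_lt_top),
      IsInput.setLIntegral_destProb N hK hin n k hs,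
      show (fun _ : Ω => (1 : ℝ)) = 1 from rfl, integral_indicator_one hE,
      measureReal_restrict_apply hE, measureReal_def]

/-! ### Almost sure limits of the throughput -/

lemma IsInput.lintegral_slotService (hK : 0 < K) (hin : N.IsInput μ X ρ) (k : Fin K) (n : ℕ) :
    ∫⁻ ω, N.slotService X ρ k n ω ∂μ = ∫⁻ ω, N.meanService (N.throughput X ρ n ω) k ∂μ := by
  have hT := IsInput.measurable_throughput N hK hin n
  have hB := (N.measurable_service_order hK k).coe_nnreal_ennreal
  calc ∫⁻ ω, N.slotService X ρ k n ω ∂μ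
      = ∫⁻ z, (N.service z.1 z.2.1 (N.order z.1 z.2.2) k : ℝ≥0∞)
          ∂μ.map (fun ω => (N.throughput X ρ n ω, slot X ρ n ω)) :=
        (lintegral_map hB (hT.prodMk (IsInput.measurable_slot N hin n))).symm
    _ = ∫⁻ t, N.meanService t k ∂μ.map (N.throughput X ρ n) := by
        rw [IsInput.map_throughput_slot N hK hin, lintegral_prod _ hB.aemeasurable]
        rfl
    _ = _ := lintegral_map (N.measurable_meanService hK k) hT

/-- Users with a larger normalized mean rate gain at least as much relative throughput in the
mean, up to the probability that the normalized mean rates are ordered the other way round. -/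
lemma IsInput.lintegral_slotService_le (hK : 0 < K) (hin : N.IsInput μ X ρ) (i j : Fin K) (n : ℕ) :
    N.r i * ∫⁻ ω, N.slotService X ρ j n ω ∂μ ≤
      N.r j * ∫⁻ ω, N.slotService X ρ i n ω ∂μ + N.r i * N.r j *
        μ {ω | N.meanRatio (N.throughput X ρ n ω) j < N.meanRatio (N.throughput X ρ n ω) i}ᶜ := by
  set A := {ω | N.meanRatio (N.throughput X ρ n ω) j < N.meanRatio (N.throughput X ρ n ω) i}
  have hT := IsInput.measurable_throughput N hK hin n
  have hA : MeasurableSet Aᶜ := (measurableSet_lt ((N.measurable_meanRatio j).comp hT)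
    ((N.measurable_meanRatio i).comp hT)).compl
  rw [IsInput.lintegral_slotService N hK hin, IsInput.lintegral_slotService N hK hin,
    ← lintegral_const_mul' _ _ ENNReal.coe_ne_top, ← lintegral_const_mul' _ _ ENNReal.coe_ne_top,
    ← lintegral_indicator_const hA, ← lintegral_add_right _ (measurable_const.indicator hA)]
  refine lintegral_mono fun ω => ?_
  by_cases hω : ω ∈ A
  · exact (N.meanService_mul_le hK hω).trans le_self_add
  · rw [Set.indicator_of_mem (Set.mem_compl hω)]
    exact le_trans (by gcongr; exact N.meanService_le _ _) le_add_self

/-- If the throughput converges almost surely to a constant vector, then the normalized mean rates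
agree in the limit. -/
lemma IsInput.meanRatio_le_of_tendsto (hK : 0 < K) (hin : N.IsInput μ X ρ) {t : Fin K → ℝ≥0}
    (ht : ∀ᵐ ω ∂μ, Tendsto (fun n => N.throughput X ρ n ω) atTop (𝓝 t)) (i j : Fin K) :
    N.meanRatio t i ≤ N.meanRatio t j := by
  by_contra! hlt
  set A : ℕ → Set Ω := fun n =>
    {ω | N.meanRatio (N.throughput X ρ n ω) j < N.meanRatio (N.throughput X ρ n ω) i}
  have hT := IsInput.measurable_throughput N hK hin
  have hA : ∀ n, MeasurableSet (A n)ᶜ := fun n =>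
    (measurableSet_lt ((N.measurable_meanRatio j).comp (hT n))
      ((N.measurable_meanRatio i).comp (hT n))).compl
  -- The strict inequality is an open condition, hence it eventually holds along the process.
  have hA0 : Tendsto (fun n => μ.real (A n)ᶜ) atTop (𝓝 0) := by
    have hopen : {s | N.meanRatio s j < N.meanRatio s i} ∈ 𝓝 t :=
      (isOpen_lt (N.continuous_meanRatio j) (N.continuous_meanRatio i)).mem_nhds hlt
    have := tendsto_measure_of_ae_tendsto_indicator_of_isFiniteMeasure (μ := μ) (A := ∅) atTop
      MeasurableSet.empty hA ?_
    · rw [measure_empty] at this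
      exact (ENNReal.tendsto_toReal ENNReal.zero_ne_top).comp this
    · filter_upwards [ht] with ω hω
      filter_upwards [hω hopen] with n hn
      simpa [A] using hn
  set ε : ℕ → ℝ≥0∞ := fun n => ENNReal.ofReal ((n : ℝ)⁻¹ * ∑ m ∈ Finset.range n, μ.real (A m)ᶜ)
  have hε : Tendsto ε atTop (𝓝 0) := by
    have h := (ENNReal.continuous_ofReal.tendsto 0).comp hA0.cesaro
    rw [ENNReal.ofReal_zero] at h
    exact h
  have hεn : ∀ n ≠ 0, ε n = (∑ m ∈ Finset.range n, μ (A m)ᶜ) / n := by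
    intro n hn
    have hn' : (0 : ℝ) < n := by exact_mod_cast Nat.pos_of_ne_zero hn
    simp only [ε]
    rw [inv_mul_eq_div, ENNReal.ofReal_div_of_pos hn', ENNReal.ofReal_natCast,
      ENNReal.ofReal_sum_of_nonneg fun m _ => measureReal_nonneg]
    congr 1
    exact Finset.sum_congr rfl fun m _ => ofReal_measureReal
  set S : ℕ → Ω → ℝ≥0 := fun n ω => (∑ m ∈ Finset.range n, X m i ω) / n
  -- `r_i * S n` dominates the throughput of user `i`. Adding it makes the difference of the two
  -- relative throughputs nonnegative, so that Fatou's lemma applies.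
  set F : ℕ → Ω → ℝ≥0 := fun n ω =>
    N.r i * N.throughput X ρ n ω j + N.r j * (N.r i * S n ω - N.throughput X ρ n ω i)
  have hTk : ∀ n k, Measurable fun ω => N.throughput X ρ n ω k := fun n k =>
    (measurable_pi_apply k).comp (hT n)
  have hX : ∀ m k, Measurable (X m k) := hin.measurable_rate
  have hS : ∀ n, Measurable (S n) := fun n =>
    (Finset.measurable_sum _ fun m _ => hX m i).div_const _
  have hF : ∀ n, Measurable (F n) := fun n =>
    ((hTk n j).const_mul _).add ((((hS n).const_mul _).sub (hTk n i)).const_mul _)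
  have hmean : ∀ n ≠ 0, ∀ k, ∫⁻ ω, N.throughput X ρ n ω k ∂μ =
      (∑ m ∈ Finset.range n, ∫⁻ ω, N.slotService X ρ k m ω ∂μ) / n := by
    intro n hn k
    have hB := fun m => (IsInput.measurable_slotService N hK hin k m).coe_nnreal_ennreal
    rw [← lintegral_finsetSum _ fun m _ => hB m, div_eq_mul_inv,
      ← lintegral_mul_const _ (Finset.measurable_sum _ fun m _ => hB m)]
    refine lintegral_congr fun ω => ?_
    rw [N.throughput_eq_div hn, ENNReal.coe_div (by exact_mod_cast hn), div_eq_mul_inv]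
    push_cast
    rfl
  have hSmean : ∀ n ≠ 0, ∫⁻ ω, S n ω ∂μ = 1 := by
    intro n hn
    have hn' : (n : ℝ≥0∞) ≠ 0 := by exact_mod_cast hn
    have : ∀ ω, (S n ω : ℝ≥0∞) = (∑ m ∈ Finset.range n, (X m i ω : ℝ≥0∞)) * (n : ℝ≥0∞)⁻¹ := by
      intro ω
      rw [ENNReal.coe_div (by exact_mod_cast hn), div_eq_mul_inv]
      push_cast
      rfl
    simp only [this]
    rw [lintegral_mul_const _ (Finset.measurable_sum _ fun m _ => (hX m i).coe_nnreal_ennreal),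
      lintegral_finsetSum _ fun m _ => (hX m i).coe_nnreal_ennreal]
    simp [IsInput.lintegral_rate N hin, ENNReal.mul_inv_cancel hn']
  have hTle : ∀ n ≠ 0, ∀ ω, N.throughput X ρ n ω i ≤ N.r i * S n ω := by
    intro n hn ω
    rw [N.throughput_eq_div hn, ← mul_div_assoc, Finset.mul_sum]
    gcongr
    exact N.service_le _ _ _ _
  have hFle : ∀ n ≠ 0, ∫⁻ ω, F n ω ∂μ ≤ N.r i * N.r j + N.r i * N.r j * ε n := by
    intro n hn
    have hrel : N.r i * ∫⁻ ω, N.throughput X ρ n ω j ∂μ ≤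
        N.r j * ∫⁻ ω, N.throughput X ρ n ω i ∂μ + N.r i * N.r j * ε n := by
      rw [hmean n hn, hmean n hn, hεn n hn, ← mul_div_assoc, ← mul_div_assoc, ← mul_div_assoc,
        ← ENNReal.add_div, Finset.mul_sum, Finset.mul_sum, Finset.mul_sum,
        ← Finset.sum_add_distrib]
      gcongr with m
      exact IsInput.lintegral_slotService_le N hK hin i j _
    have hsum : N.r j * ∫⁻ ω, N.throughput X ρ n ω i ∂μ + ∫⁻ ω, F n ω ∂μ =
        N.r i * ∫⁻ ω, N.throughput X ρ n ω j ∂μ + N.r i * N.r j := by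
      have hr : (N.r i * N.r j : ℝ≥0∞) = N.r i * N.r j * ∫⁻ ω, S n ω ∂μ := by
        rw [hSmean n hn, mul_one]
      rw [hr, ← lintegral_const_mul' _ _ ENNReal.coe_ne_top,
        ← lintegral_const_mul' _ _ ENNReal.coe_ne_top,
        ← lintegral_const_mul' _ _ (by finiteness),
        ← lintegral_add_right _ (hF n).coe_nnreal_ennreal,
        ← lintegral_add_right _ ((hS n).coe_nnreal_ennreal.const_mul _)]
      refine lintegral_congr fun ω => ?_
      have : N.r j * N.throughput X ρ n ω i + F n ω =
          N.r i * N.throughput X ρ n ω j + N.r i * N.r j * S n ω := by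
        have h := add_tsub_cancel_of_le (hTle n hn ω)
        calc N.r j * N.throughput X ρ n ω i + F n ω
            = N.r i * N.throughput X ρ n ω j + N.r j *
              (N.throughput X ρ n ω i + (N.r i * S n ω - N.throughput X ρ n ω i)) := by
              simp only [F]; ring
          _ = _ := by rw [h]; ring
      exact_mod_cast this
    have hfin : N.r j * ∫⁻ ω, N.throughput X ρ n ω i ∂μ ≠ ∞ := by
      refine ENNReal.mul_ne_top ENNReal.coe_ne_top (ne_top_of_le_ne_top
        (b := N.r i * ∫⁻ ω, S n ω ∂μ) (by rw [hSmean n hn]; finiteness) ?_)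
      rw [← lintegral_const_mul' _ _ ENNReal.coe_ne_top]
      exact lintegral_mono fun ω => by
        rw [← ENNReal.coe_mul, ENNReal.coe_le_coe]
        exact hTle n hn ω
    refine (ENNReal.add_le_add_iff_left hfin).1 ?_
    rw [hsum, add_comm (N.r i * N.r j : ℝ≥0∞), ← add_assoc]
    gcongr
  have hFlim : ∀ᵐ ω ∂μ, Tendsto (fun n => F n ω) atTop
      (𝓝 (N.r i * t j + N.r j * (N.r i - t i))) := by
    filter_upwards [ht, IsInput.tendsto_average_rate N hin i] with ω hω hSω
    have hk := tendsto_pi_nhds.1 hω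
    simpa using ((hk j).const_mul (N.r i)).add
      (((hSω.const_mul (N.r i)).sub (hk i)).const_mul (N.r j))
  have hfatou : ((N.r i * t j + N.r j * (N.r i - t i) : ℝ≥0) : ℝ≥0∞) ≤ N.r i * N.r j := by
    have hlim : Tendsto (fun n => (N.r i * N.r j + N.r i * N.r j * ε n : ℝ≥0∞)) atTop
        (𝓝 (N.r i * N.r j)) := by
      simpa using (ENNReal.Tendsto.const_mul hε (.inr (by finiteness))).const_add
        (N.r i * N.r j : ℝ≥0∞)
    calc ((N.r i * t j + N.r j * (N.r i - t i) : ℝ≥0) : ℝ≥0∞)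
        = ∫⁻ ω, liminf (fun n => (F n ω : ℝ≥0∞)) atTop ∂μ := by
          rw [← mul_one (((N.r i * t j + N.r j * (N.r i - t i) : ℝ≥0) : ℝ≥0∞)),
            ← measure_univ (μ := μ), ← lintegral_const]
          refine lintegral_congr_ae ?_
          filter_upwards [hFlim] with ω hω
          exact (ENNReal.tendsto_coe.2 hω).liminf_eq.symm
      _ ≤ liminf (fun n => ∫⁻ ω, F n ω ∂μ) atTop :=
          lintegral_liminf_le fun n => (hF n).coe_nnreal_ennreal
      _ ≤ liminf (fun n => (N.r i * N.r j + N.r i * N.r j * ε n : ℝ≥0∞)) atTop := by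
          refine liminf_le_liminf ?_
          filter_upwards [eventually_ne_atTop 0] with n hn
          exact hFle n hn
      _ = N.r i * N.r j := hlim.liminf_eq
  have hle : N.r i * t j ≤ N.r j * t i := by
    have h1 : N.r i * t j + N.r j * (N.r i - t i) ≤ N.r i * N.r j := by exact_mod_cast hfatou
    have h2 : N.r i * N.r j ≤ N.r j * t i + N.r j * (N.r i - t i) := by
      rw [← mul_add, mul_comm (N.r i)]
      gcongr
      exact le_add_tsub
    exact le_of_add_le_add_right (h1.trans h2)
  refine absurd hlt (not_lt.2 ?_)
  have htop : (N.r j : ℝ≥0∞) / t j ≠ ∞ := hlt.ne_top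
  have htj : (t j : ℝ≥0∞) ≠ 0 := by
    intro h0
    rw [h0, ENNReal.div_zero (by exact_mod_cast (N.r_pos j).ne')] at htop
    exact htop rfl
  unfold meanRatio
  rw [ENNReal.div_le_iff_le_mul (.inr htop) (.inl ENNReal.coe_ne_top), ← ENNReal.mul_div_right_comm,
    ENNReal.le_div_iff_mul_le (.inl htj) (.inl ENNReal.coe_ne_top)]
  exact_mod_cast hle

end ThroughputProcess

end JPS.Network

theorem corollary1 {K : ℕ} (hK : 0 < K) (N : JPS.Network K)
    {Ω : Type*} [MeasurableSpace Ω] (μ : Measure Ω) [IsProbabilityMeasure μ]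
    (X : ℕ → Fin K → Ω → ℝ≥0) (ρ : ℕ → Ω → Equiv.Perm (Fin K)) (hin : N.IsInput μ X ρ) :
    -- `destProb` is the conditional probability of being the destination, given the throughput
    (∀ (n : ℕ) (k : Fin K),
      μ[(N.destEvent X ρ n k).indicator (fun _ => (1 : ℝ)) |
          MeasurableSpace.comap (N.throughput X ρ n) inferInstance]
        =ᵐ[μ] fun ω => (N.destProb (N.throughput X ρ n ω) k).toReal) ∧
    -- there is exactly one steady state
    (∃! t : Fin K → ℝ≥0, N.IsSteadyState t) ∧
    -- at a steady state, and at any almost sure limit of the throughput, it is `1 / K`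
    (∀ t : Fin K → ℝ≥0,
      (N.IsSteadyState t ∨
        ∀ᵐ ω ∂μ, Tendsto (fun n => N.throughput X ρ n ω) atTop (𝓝 t)) →
      ∀ k, N.destProb t k = 1 / (K : ℝ≥0∞)) := by
  refine ⟨JPS.Network.IsInput.condExp_destEvent N hK hin, N.existsUnique_isSteadyState hK, ?_⟩
  rintro t (ht | ht) k
  · exact N.destProb_eq hK (JPS.Network.IsSteadyState.meanRatio_eq N hK ht) k
  · have hle := JPS.Network.IsInput.meanRatio_le_of_tendsto N hK hin ht
    exact N.destProb_eq hK (fun i j => le_antisymm (hle i j) (hle j i)) k
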